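/- Fix $N$, matrices $A, C \in \mathbb{R}^{N\times N}$ with $\operatorname{rank} A = \operatorname{rank} C = N$, and $\sigma_v>0$. For each $M\in\mathbb{N}$ let $G_M\in\mathbb{R}^{M\times N}$ and $R_M=\sigma_v^2 I_M$, and consider the Gaussian dynamic factor model $$x_{t+1}=Ax_t+Cw_{t+1},\qquad y_t=G_Mx_t+v_t,\qquad w_t\sim\mathcal N(0,I_N),\quad v_t\sim\mathcal N(0,R_M),$$ with serially and mutually independent shocks $w$ and measurement errors $v$. Let $\|\cdot\|$ be the Frobenius norm. Assume that $\operatorname{rank} G_M=N$ for all large $M$ and that $G_M^\top G_M$ is of exact order $M$: $\|G_M^\top G_M\|=O(M)$ and $\|(G_M^\top G_M)^{-1}\|=O(1/M)$ as $M\to\infty$. For a positive semidefinite $\Sigma\in\mathbb{R}^{N\times N}$ put $$K_M(\Sigma)=A\Sigma G_M^\top\,(G_M\Sigma G_M^\top+R_M)^{-1}.$$ (i) For every $M$ with $\operatorname{rank} G_M=N$ there is exactly one positive semidefinite $\Sigma=\Sigma_{\infty,M}$ (the steady-state prediction covariance) that solves, with $K=K_M(\Sigma)$, the Riccati equation $$\Sigma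 = CC^\top + K R_M K^\top + (A-KG_M)\,\Sigma\,(A-KG_M)^\top,$$ and it is invertible. (ii) With $K_M=K_M(\Sigma_{\infty,M})$, as $M\to\infty$, $$\Sigma_{\infty,M}\to CC^\top,\qquad A-K_MG_M\to 0,\qquad \limsup_{M\to\infty} M\,\|A-K_MG_M\|<\infty .$$ (iii) The three claims of (ii) hold as well if $\Sigma_{\infty,M}$ is replaced, for any fixed $t$, by the prediction covariance $\mathbb{E}\big[(x_t-\mathbb{E}[x_t\mid y_s,\,s<t])(x_t-\mathbb{E}[x_t\mid y_s,\,s<t])^\top\big]$ of a stationary Gaussian realization $(x_t,y_t)_{t\in\mathbb{Z}}$ of the $M$-th model, in which $x$ is independent of $v$ and, for each $t$, the shocks $(w_s)_{s>t}$ are independent of $(x_s)_{s\le t}$ and $v$ jointly. -/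

import Mathlib

open Filter Topology MeasureTheory ProbabilityTheory Asymptotics
open scoped Matrix Matrix.Norms.Frobenius

noncomputable section

/-- The filter gain `K = A Σ Gᵀ Ω⁻¹` with `Ω = G Σ Gᵀ + R`. -/
def kalmanGain {N M : ℕ} (A : Matrix (Fin N) (Fin N) ℝ) (G : Matrix (Fin M) (Fin N) ℝ)
    (R : Matrix (Fin M) (Fin M) ℝ) (S : Matrix (Fin N) (Fin N) ℝ) :
    Matrix (Fin N) (Fin M) ℝ :=
  A * S * Gᵀ * (G * S * Gᵀ + R)⁻¹

/-- The filter matrix `A - K G` belonging to the prediction covariance `S`. -/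
def filterMatrix {N M : ℕ} (A : Matrix (Fin N) (Fin N) ℝ) (G : Matrix (Fin M) (Fin N) ℝ)
    (R : Matrix (Fin M) (Fin M) ℝ) (S : Matrix (Fin N) (Fin N) ℝ) :
    Matrix (Fin N) (Fin N) ℝ :=
  A - kalmanGain A G R S * G

/-- `S` is a steady-state prediction covariance: a positive semidefinite solution of
`S = C Cᵀ + K R Kᵀ + (A - K G) S (A - K G)ᵀ`, where `K` is the gain belonging to `S`. -/
structure IsSteadyStateCov {N M : ℕ} (A C : Matrix (Fin N) (Fin N) ℝ)
    (G : Matrix (Fin M) (Fin N) ℝ) (R : Matrix (Fin M) (Fin M) ℝ)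
    (S : Matrix (Fin N) (Fin N) ℝ) : Prop where
  posSemidef : S.PosSemidef
  riccati : S = C * Cᵀ + kalmanGain A G R S * R * (kalmanGain A G R S)ᵀ
    + filterMatrix A G R S * S * (filterMatrix A G R S)ᵀ

/-- The restrictions on a sequence of dynamic factor models indexed by the number `M` of
observables. All norms are Frobenius norms; `Gᵀ G` is of exact order `M`. -/
structure FactorModelAssumption {N : ℕ} (A : Matrix (Fin N) (Fin N) ℝ)
    (G : ∀ M : ℕ, Matrix (Fin M) (Fin N) ℝ) (R : ∀ M : ℕ, Matrix (Fin M) (Fin M) ℝ)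
    (σ : ℝ) : Prop where
  rank_A : A.rank = N
  rank_G : ∀ᶠ M in atTop, (G M).rank = N
  gram_isBigO : (fun M : ℕ => ‖(G M)ᵀ * G M‖) =O[atTop] fun M : ℕ => (M : ℝ)
  gram_inv_isBigO : (fun M : ℕ => ‖((G M)ᵀ * G M)⁻¹‖) =O[atTop] fun M : ℕ => (M : ℝ)⁻¹
  sigma_pos : 0 < σ
  noise : ∀ M, R M = σ ^ 2 • (1 : Matrix (Fin M) (Fin M) ℝ)

/-- A stationary Gaussian realization, with time running over `ℤ`, of
`x (t+1) = A x t + C w (t+1)`, `y t = G x t + v t`, where `w t ∼ N(0, I)` and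
`v t ∼ N(0, σ² I)` are serially and mutually independent, and where the shocks after time `t`
are independent of the states up to time `t`. -/
structure IsStationaryDFM {N M : ℕ} {Ω : Type*} [MeasurableSpace Ω] (μ : Measure Ω)
    (A C : Matrix (Fin N) (Fin N) ℝ) (G : Matrix (Fin M) (Fin N) ℝ) (σ : ℝ)
    (x w : ℤ → Ω → Fin N → ℝ) (y v : ℤ → Ω → Fin M → ℝ) : Prop where
  measurable_x : ∀ t, Measurable (x t)
  measurable_w : ∀ t, Measurable (w t)
  measurable_y : ∀ t, Measurable (y t)
  measurable_v : ∀ t, Measurable (v t)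
  transition : ∀ t, ∀ᵐ ω ∂μ, x (t + 1) ω = A *ᵥ x t ω + C *ᵥ w (t + 1) ω
  measurement : ∀ t, ∀ᵐ ω ∂μ, y t ω = G *ᵥ x t ω + v t ω
  law_w : ∀ t, μ.map (w t) = Measure.pi fun _ => gaussianReal 0 1
  law_v : ∀ t, μ.map (v t) = Measure.pi fun _ => gaussianReal 0 (σ ^ 2).toNNReal
  iIndep_w : iIndepFun w μ
  iIndep_v : iIndepFun v μ
  indep_w_v : IndepFun (fun ω t => w t ω) (fun ω t => v t ω) μ
  indep_x_v : IndepFun (fun ω t => x t ω) (fun ω t => v t ω) μ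
  causal : ∀ t : ℤ, IndepFun
    (fun ω => ((fun s : Set.Iic t => x s ω), (fun s : ℤ => v s ω)))
    (fun ω => fun s : Set.Ioi t => w s ω) μ
  gaussian_x : ∀ t, IsGaussian (μ.map (x t))
  stationary_x : ∀ s t, μ.map (x s) = μ.map (x t)

/-- The information in the observables strictly before time `t`. -/
def pastObs {M : ℕ} {Ω : Type*} (y : ℤ → Ω → Fin M → ℝ) (t : ℤ) : MeasurableSpace Ω :=
  ⨆ s : Set.Iio t, MeasurableSpace.comap (y s) inferInstance

/-- The prediction error `x t - E[x t | y s, s < t]`, coordinate by coordinate. -/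
def predictionError {N M : ℕ} {Ω : Type*} [MeasurableSpace Ω] (μ : Measure Ω)
    (x : ℤ → Ω → Fin N → ℝ) (y : ℤ → Ω → Fin M → ℝ) (t : ℤ) (ω : Ω) (i : Fin N) : ℝ :=
  x t ω i - (μ[fun ω' => x t ω' i | pastObs y t]) ω

/-- The covariance matrix of the prediction error at time `t`. -/
def predictionCov {N M : ℕ} {Ω : Type*} [MeasurableSpace Ω] (μ : Measure Ω)
    (x : ℤ → Ω → Fin N → ℝ) (y : ℤ → Ω → Fin M → ℝ) (t : ℤ) : Matrix (Fin N) (Fin N) ℝ :=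
  Matrix.of fun i j =>
    ∫ ω, predictionError μ x y t ω i * predictionError μ x y t ω j ∂μ

/-- The three asymptotic claims for covariances `S M`: `S M → C Cᵀ`, `A - K G → 0` and
`limsup M ‖A - K G‖ < ∞`. -/
structure FilterCollapses {N : ℕ} (A C : Matrix (Fin N) (Fin N) ℝ)
    (G : ∀ M : ℕ, Matrix (Fin M) (Fin N) ℝ) (R : ∀ M : ℕ, Matrix (Fin M) (Fin M) ℝ)
    (S : ℕ → Matrix (Fin N) (Fin N) ℝ) : Prop where
  cov_tendsto : Tendsto S atTop (𝓝 (C * Cᵀ))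
  filter_tendsto : Tendsto (fun M => filterMatrix A (G M) (R M) (S M)) atTop (𝓝 0)
  rate : limsup (fun M : ℕ =>
    (((M : ℝ) * ‖filterMatrix A (G M) (R M) (S M)‖ : ℝ) : EReal)) atTop < ⊤

end

/-! ### Loewner order: quadratic forms, monotone limits, congruence. -/

section LoewnerOrder

open scoped MatrixOrder

variable {N M : ℕ}

/-! Write `Γ = Gᵀ * G`. Both kinds of covariance are squeezed in the Loewner order between `C * Cᵀ`
and `C * Cᵀ + σ ^ 2 • (A * Γ⁻¹ * Aᵀ)`. The fresh shock is unpredictable, which gives the lower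
bound. The least squares gain `L = A * Γ⁻¹ * Gᵀ` satisfies `L * G = A`, so it removes the state
error and leaves only noise; the optimal filter does no worse. Since `Γ⁻¹ = O(1/M)`, the bounds
merge. The rate comes from `filterMatrix_eq`, which writes `A - K G` as `Γ⁻¹` times bounded factors;
`FactorModelAssumption.filterCollapses` combines the two.

For the steady state, the Riccati map is the minimum of `josephForm` over all gains
(`josephForm_sub_riccatiMap`), hence monotone; iterating it from `0` gives an increasing sequence,
bounded through `L`, whose limit is a fixed point. Uniqueness follows by contracting the relative
gap between two fixed points (`IsSteadyStateCov.le_smul_of_le_smul`).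

For stationary realizations, the squeeze is a statement about scalar prediction problems, one for
each direction `a` (`dotProduct_predictionCov_mulVec`). -/

lemma Matrix.le_iff_dotProduct_mulVec_le {P Q : Matrix (Fin N) (Fin N) ℝ} (hP : P.IsHermitian)
    (hQ : Q.IsHermitian) : P ≤ Q ↔ ∀ a, a ⬝ᵥ P *ᵥ a ≤ a ⬝ᵥ Q *ᵥ a := by
  rw [Matrix.le_iff, Matrix.posSemidef_iff_dotProduct_mulVec]
  rw [and_iff_right (hQ.sub hP)]
  simp [Matrix.sub_mulVec, dotProduct_sub]

lemma Matrix.dotProduct_mulVec_le_of_le {P Q : Matrix (Fin N) (Fin N) ℝ} (h : P ≤ Q)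
    (a : Fin N → ℝ) : a ⬝ᵥ P *ᵥ a ≤ a ⬝ᵥ Q *ᵥ a := by
  have := (Matrix.le_iff.1 h).dotProduct_mulVec_nonneg a
  simpa [Matrix.sub_mulVec, dotProduct_sub] using this

lemma Matrix.apply_eq_polarization {P : Matrix (Fin N) (Fin N) ℝ} (hP : P.IsHermitian)
    (i j : Fin N) :
    P i j = ((Pi.single i 1 + Pi.single j 1) ⬝ᵥ P *ᵥ (Pi.single i 1 + Pi.single j 1)
      - Pi.single i 1 ⬝ᵥ P *ᵥ Pi.single i 1 - Pi.single j 1 ⬝ᵥ P *ᵥ Pi.single j 1) / 2 := by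
  have h : P j i = P i j := by simpa using hP.apply i j
  simp [Matrix.mulVec_add, h]
  ring

lemma Matrix.tendsto_iff_entry {ι : Type*} {l : Filter ι} {S : ι → Matrix (Fin N) (Fin M) ℝ}
    {T : Matrix (Fin N) (Fin M) ℝ} :
    Tendsto S l (𝓝 T) ↔ ∀ i j, Tendsto (fun k => S k i j) l (𝓝 (T i j)) :=
  tendsto_pi_nhds.trans (forall_congr' fun _ => tendsto_pi_nhds)

lemma Matrix.tendsto_of_dotProduct_mulVec {ι : Type*} {l : Filter ι}
    {S : ι → Matrix (Fin N) (Fin N) ℝ} {T : Matrix (Fin N) (Fin N) ℝ}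
    (hS : ∀ᶠ k in l, (S k).IsHermitian) (hT : T.IsHermitian)
    (h : ∀ a, Tendsto (fun k => a ⬝ᵥ S k *ᵥ a) l (𝓝 (a ⬝ᵥ T *ᵥ a))) :
    Tendsto S l (𝓝 T) := by
  refine Matrix.tendsto_iff_entry.2 fun i j => ?_
  rw [Matrix.apply_eq_polarization hT i j]
  refine Tendsto.congr' ?_ ((((h _).sub (h _)).sub (h _)).div_const 2)
  filter_upwards [hS] with k hk
  exact (Matrix.apply_eq_polarization hk i j).symm

lemma Matrix.tendsto_dotProduct_mulVec {ι : Type*} {l : Filter ι}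
    {S : ι → Matrix (Fin N) (Fin N) ℝ} {T : Matrix (Fin N) (Fin N) ℝ}
    (h : Tendsto S l (𝓝 T)) (a : Fin N → ℝ) :
    Tendsto (fun k => a ⬝ᵥ S k *ᵥ a) l (𝓝 (a ⬝ᵥ T *ᵥ a)) := by
  have hc : Continuous fun P : Matrix (Fin N) (Fin N) ℝ => a ⬝ᵥ P *ᵥ a :=
    continuous_const.dotProduct (continuous_id.matrix_mulVec continuous_const)
  exact (hc.tendsto T).comp h

/-- Monotone convergence in the Loewner order. -/
lemma Matrix.exists_tendsto_of_monotone {S : ℕ → Matrix (Fin N) (Fin N) ℝ}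
    {B : Matrix (Fin N) (Fin N) ℝ} (hpos : ∀ n, (S n).PosSemidef) (hmono : Monotone S)
    (hB : ∀ n, S n ≤ B) :
    ∃ T : Matrix (Fin N) (Fin N) ℝ, T.PosSemidef ∧ Tendsto S atTop (𝓝 T) := by
  have hq : ∀ a : Fin N → ℝ, ∃ q, Tendsto (fun n => a ⬝ᵥ S n *ᵥ a) atTop (𝓝 q) := fun a =>
    ⟨_, tendsto_atTop_ciSup
      (fun m n hmn => Matrix.dotProduct_mulVec_le_of_le (hmono hmn) a)
      ⟨a ⬝ᵥ B *ᵥ a, by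
        rintro _ ⟨n, rfl⟩
        exact Matrix.dotProduct_mulVec_le_of_le (hB n) a⟩⟩
  choose q hq using hq
  -- The candidate limit is the polarization of the limits of the quadratic forms.
  have hT : Tendsto S atTop (𝓝 (Matrix.of fun i j : Fin N =>
      (q (Pi.single i 1 + Pi.single j 1) - q (Pi.single i 1) - q (Pi.single j 1)) / 2)) := by
    refine Matrix.tendsto_iff_entry.2 fun i j => ?_
    refine Tendsto.congr (fun n => (Matrix.apply_eq_polarization (hpos n).isHermitian i j).symm) ?_
    exact ((((hq _).sub (hq _)).sub (hq _)).div_const 2)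
  refine ⟨_, .of_dotProduct_mulVec_nonneg ?_ fun a => ?_, hT⟩
  · ext i j
    simp only [Matrix.conjTranspose_apply, Matrix.of_apply, star_trivial,
      add_comm (Pi.single (M := fun _ : Fin N => ℝ) j 1) (Pi.single i 1)]
    ring
  · exact ge_of_tendsto' (Matrix.tendsto_dotProduct_mulVec hT a)
      fun n => by simpa using (hpos n).dotProduct_mulVec_nonneg a

lemma Matrix.mul_mul_transpose_mono {P Q : Matrix (Fin N) (Fin N) ℝ} (h : P ≤ Q)
    (B : Matrix (Fin M) (Fin N) ℝ) : B * P * Bᵀ ≤ B * Q * Bᵀ := by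
  rw [Matrix.le_iff] at h ⊢
  simpa [Matrix.mul_sub, Matrix.sub_mul] using h.mul_mul_conjTranspose_same B

lemma Matrix.PosSemidef.mul_mul_transpose_same {P : Matrix (Fin N) (Fin N) ℝ} (h : P.PosSemidef)
    (B : Matrix (Fin M) (Fin N) ℝ) : (B * P * Bᵀ).PosSemidef := by
  simpa using h.mul_mul_conjTranspose_same B

lemma Matrix.posSemidef_mul_transpose_self (B : Matrix (Fin M) (Fin N) ℝ) :
    (B * Bᵀ).PosSemidef := by
  simpa using Matrix.posSemidef_self_mul_conjTranspose B

lemma Matrix.PosSemidef.transpose_eq {P : Matrix (Fin N) (Fin N) ℝ} (h : P.PosSemidef) :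
    Pᵀ = P := by
  simpa using h.isHermitian.eq

lemma Matrix.isUnit_of_rank_eq {P : Matrix (Fin N) (Fin N) ℝ} (h : P.rank = N) : IsUnit P := by
  refine Matrix.linearIndependent_rows_iff_isUnit.1 ?_
  rw [linearIndependent_iff_card_eq_finrank_span, Set.finrank, ← Matrix.rank_eq_finrank_span_row,
    h, Fintype.card_fin]

/-- A crude entrywise bound suffices; the summand `1` in the witness makes `c ≥ 1`, so that `1 -
c⁻¹` can serve as a contraction factor. -/
lemma Matrix.exists_le_smul_one (P : Matrix (Fin N) (Fin N) ℝ) (hP : P.IsHermitian) :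
    ∃ c : ℝ, 1 ≤ c ∧ P ≤ c • (1 : Matrix (Fin N) (Fin N) ℝ) := by
  refine ⟨1 + ∑ i, ∑ j, |P i j|, by simp; positivity, ?_⟩
  rw [Matrix.le_iff_dotProduct_mulVec_le hP (by simp [Matrix.IsHermitian])]
  intro a
  have hsq : ∀ k, a k ^ 2 ≤ ∑ l, a l ^ 2 := fun k =>
    Finset.single_le_sum (f := fun l => a l ^ 2) (fun l _ => sq_nonneg (a l)) (Finset.mem_univ k)
  have hterm : ∀ i j, a i * (P i j * a j) ≤ |P i j| * ∑ l, a l ^ 2 := fun i j =>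
    calc a i * (P i j * a j) ≤ |a i * (P i j * a j)| := le_abs_self _
      _ = |P i j| * (|a i| * |a j|) := by rw [abs_mul, abs_mul]; ring
      _ ≤ |P i j| * ∑ l, a l ^ 2 := by
          gcongr
          nlinarith [hsq i, hsq j, sq_abs (a i), sq_abs (a j), sq_nonneg (|a i| - |a j|)]
  calc a ⬝ᵥ P *ᵥ a = ∑ i, ∑ j, a i * (P i j * a j) := by
        simp [dotProduct, Matrix.mulVec, Finset.mul_sum]
    _ ≤ ∑ i, ∑ j, |P i j| * ∑ l, a l ^ 2 :=
        Finset.sum_le_sum fun i _ => Finset.sum_le_sum fun j _ => hterm i j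
    _ = (∑ i, ∑ j, |P i j|) * ∑ l, a l ^ 2 := by simp only [Finset.sum_mul]
    _ ≤ (1 + ∑ i, ∑ j, |P i j|) * ∑ l, a l ^ 2 := by
        gcongr
        linarith
    _ = _ := by
        simp [Matrix.smul_mulVec, dotProduct, pow_two, Finset.mul_sum, mul_left_comm]

lemma Matrix.exists_le_smul_mul_transpose {C P : Matrix (Fin N) (Fin N) ℝ} (hC : IsUnit C)
    (hP : P.IsHermitian) : ∃ c : ℝ, 1 ≤ c ∧ P ≤ c • (C * Cᵀ) := by
  have hdet := (Matrix.isUnit_iff_isUnit_det C).1 hC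
  have hherm : (C⁻¹ * P * (C⁻¹)ᵀ).IsHermitian := by
    simpa using Matrix.isHermitian_mul_mul_conjTranspose C⁻¹ hP
  obtain ⟨c, hc, h⟩ := Matrix.exists_le_smul_one _ hherm
  refine ⟨c, hc, ?_⟩
  have := Matrix.mul_mul_transpose_mono h C
  have e : C * (C⁻¹ * P * (C⁻¹)ᵀ) * Cᵀ = C * C⁻¹ * P * (C * C⁻¹)ᵀ := by
    simp only [Matrix.transpose_mul, Matrix.mul_assoc]
  rw [e, Matrix.mul_nonsing_inv _ hdet] at this
  simpa using this

lemma Matrix.smul_mono_of_nonneg {P Q : Matrix (Fin N) (Fin N) ℝ} (h : P ≤ Q) {c : ℝ}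
    (hc : 0 ≤ c) : c • P ≤ c • Q := by
  rw [Matrix.le_iff, ← smul_sub]
  exact (Matrix.le_iff.1 h).smul hc

end LoewnerOrder

/-! ### The Riccati equation: existence and uniqueness of the steady state. -/

section Riccati

open scoped MatrixOrder

variable {N M : ℕ}

/-- The prediction covariance after one step from the covariance `S` if the gain `L` is used. -/
noncomputable def josephForm (A C : Matrix (Fin N) (Fin N) ℝ) (G : Matrix (Fin M) (Fin N) ℝ)
    (R : Matrix (Fin M) (Fin M) ℝ) (S : Matrix (Fin N) (Fin N) ℝ) (L : Matrix (Fin N) (Fin M) ℝ) :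
    Matrix (Fin N) (Fin N) ℝ :=
  C * Cᵀ + L * R * Lᵀ + (A - L * G) * S * (A - L * G)ᵀ

/-- The Riccati map. -/
noncomputable def riccatiMap (A C : Matrix (Fin N) (Fin N) ℝ) (G : Matrix (Fin M) (Fin N) ℝ)
    (R : Matrix (Fin M) (Fin M) ℝ) (S : Matrix (Fin N) (Fin N) ℝ) : Matrix (Fin N) (Fin N) ℝ :=
  josephForm A C G R S (kalmanGain A G R S)

variable {A C : Matrix (Fin N) (Fin N) ℝ} {G : Matrix (Fin M) (Fin N) ℝ}
  {R : Matrix (Fin M) (Fin M) ℝ} {S T : Matrix (Fin N) (Fin N) ℝ}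

lemma innovationCov_posDef (hR : R.PosDef) (hS : S.PosSemidef) : (G * S * Gᵀ + R).PosDef :=
  hR.posSemidef_add (hS.mul_mul_transpose_same G)

/-- Completing the square in the gain: `K * (G * S * Gᵀ + R) = A * S * Gᵀ` makes the terms linear in
`L - K` cancel. Hence the Kalman gain is optimal. -/
lemma josephForm_sub_riccatiMap (hR : R.PosDef) (hS : S.PosSemidef)
    (L : Matrix (Fin N) (Fin M) ℝ) :
    josephForm A C G R S L - riccatiMap A C G R S =
      (L - kalmanGain A G R S) * (G * S * Gᵀ + R) * (L - kalmanGain A G R S)ᵀ := by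
  have hΩ := innovationCov_posDef (G := G) hR hS
  have hdet := (Matrix.isUnit_iff_isUnit_det _).1 hΩ.isUnit
  have h1 : kalmanGain A G R S * (G * S * Gᵀ + R) = A * S * Gᵀ := by
    rw [kalmanGain, Matrix.nonsing_inv_mul_cancel_right _ _ hdet]
  have h2 : (G * S * Gᵀ + R) * (kalmanGain A G R S)ᵀ = G * S * Aᵀ := by
    have := congrArg Matrix.transpose h1
    rw [Matrix.transpose_mul, hΩ.posSemidef.transpose_eq] at this
    simpa [hS.transpose_eq, Matrix.mul_assoc] using this
  have hJ : ∀ L : Matrix (Fin N) (Fin M) ℝ, josephForm A C G R S L =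
      C * Cᵀ + A * S * Aᵀ - L * (G * S * Aᵀ) - A * S * Gᵀ * Lᵀ
        + L * (G * S * Gᵀ + R) * Lᵀ := fun L => by
    simp only [josephForm, Matrix.transpose_sub, Matrix.transpose_mul, Matrix.mul_sub,
      Matrix.sub_mul, Matrix.mul_add, Matrix.add_mul, Matrix.mul_assoc]
    abel
  rw [riccatiMap, hJ, hJ, ← h1, ← h2]
  simp only [Matrix.transpose_sub, Matrix.mul_sub, Matrix.sub_mul, Matrix.mul_assoc]
  abel

lemma riccatiMap_le_josephForm (hR : R.PosDef) (hS : S.PosSemidef)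
    (L : Matrix (Fin N) (Fin M) ℝ) : riccatiMap A C G R S ≤ josephForm A C G R S L := by
  rw [Matrix.le_iff, josephForm_sub_riccatiMap hR hS]
  exact (innovationCov_posDef hR hS).posSemidef.mul_mul_transpose_same _

lemma josephForm_mono (h : S ≤ T) (L : Matrix (Fin N) (Fin M) ℝ) :
    josephForm A C G R S L ≤ josephForm A C G R T L :=
  add_le_add_right (Matrix.mul_mul_transpose_mono h _) _

/-- The gain that is optimal for `T` is merely admissible for `S`. -/
lemma riccatiMap_mono (hR : R.PosDef) (hS : S.PosSemidef) (h : S ≤ T) :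
    riccatiMap A C G R S ≤ riccatiMap A C G R T :=
  (riccatiMap_le_josephForm hR hS _).trans (josephForm_mono h _)

lemma mul_transpose_le_josephForm (hR : R.PosDef) (hS : S.PosSemidef)
    (L : Matrix (Fin N) (Fin M) ℝ) : C * Cᵀ ≤ josephForm A C G R S L := by
  rw [Matrix.le_iff, josephForm, add_assoc, add_sub_cancel_left]
  exact (hR.posSemidef.mul_mul_transpose_same L).add (hS.mul_mul_transpose_same _)

lemma riccatiMap_posSemidef (hR : R.PosDef) (hS : S.PosSemidef) :
    (riccatiMap A C G R S).PosSemidef :=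
  Matrix.nonneg_iff_posSemidef.1 <|
    (Matrix.nonneg_iff_posSemidef.2 (Matrix.posSemidef_mul_transpose_self C)).trans
      (mul_transpose_le_josephForm hR hS _)

lemma Matrix.continuousAt_nonsing_inv {P : Matrix (Fin M) (Fin M) ℝ} (hP : IsUnit P) :
    ContinuousAt (fun Q : Matrix (Fin M) (Fin M) ℝ => Q⁻¹) P := by
  simp only [Matrix.nonsing_inv_eq_ringInverse]
  obtain ⟨u, rfl⟩ := hP
  exact NormedRing.inverse_continuousAt u

lemma continuousAt_riccatiMap (hR : R.PosDef) (hS : S.PosSemidef) :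
    ContinuousAt (riccatiMap A C G R) S := by
  have hid : ContinuousAt (fun T : Matrix (Fin N) (Fin N) ℝ => T) S := continuousAt_id
  have hmul : ∀ {a b c : ℕ} {f : Matrix (Fin N) (Fin N) ℝ → Matrix (Fin a) (Fin b) ℝ}
      {g : Matrix (Fin N) (Fin N) ℝ → Matrix (Fin b) (Fin c) ℝ},
      ContinuousAt f S → ContinuousAt g S → ContinuousAt (fun T => f T * g T) S := fun hf hg =>
    ((continuous_fst.matrix_mul continuous_snd).continuousAt (x := (_, _))).comp₂ hf hg
  have htr : ∀ {a b : ℕ} {f : Matrix (Fin N) (Fin N) ℝ → Matrix (Fin a) (Fin b) ℝ},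
      ContinuousAt f S → ContinuousAt (fun T => (f T)ᵀ) S := fun hf =>
    (continuous_id.matrix_transpose.continuousAt).comp hf
  have hinv : ContinuousAt (fun T => (G * T * Gᵀ + R)⁻¹) S :=
    ContinuousAt.comp (f := fun T => G * T * Gᵀ + R)
      (Matrix.continuousAt_nonsing_inv (innovationCov_posDef hR hS).isUnit)
      ((hmul (hmul continuousAt_const hid) continuousAt_const).add continuousAt_const)
  have hK : ContinuousAt (fun T => kalmanGain A G R T) S :=
    hmul (hmul (hmul continuousAt_const hid) continuousAt_const) hinv
  have hF : ContinuousAt (fun T => A - kalmanGain A G R T * G) S :=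
    continuousAt_const.sub (hmul hK continuousAt_const)
  exact (continuousAt_const.add (hmul (hmul hK continuousAt_const) (htr hK))).add
    (hmul (hmul hF hid) (htr hF))

lemma isSteadyStateCov_iff :
    IsSteadyStateCov A C G R S ↔ S.PosSemidef ∧ riccatiMap A C G R S = S :=
  ⟨fun h => ⟨h.1, h.2.symm⟩, fun h => ⟨h.1, h.2.symm⟩⟩

lemma exists_isSteadyStateCov (hR : R.PosDef) {L : Matrix (Fin N) (Fin M) ℝ} (hL : L * G = A) :
    ∃ S, IsSteadyStateCov A C G R S := by
  set f := riccatiMap A C G R with hf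
  have hpos : ∀ n, (f^[n] 0).PosSemidef := fun n => by
    induction n with
    | zero => exact .zero
    | succ n ih =>
      rw [Function.iterate_succ_apply']
      exact riccatiMap_posSemidef hR ih
  have hmono : Monotone fun n => f^[n] 0 := monotone_nat_of_le_succ fun n => by
    induction n with
    | zero => exact Matrix.nonneg_iff_posSemidef.2 (hpos 1)
    | succ n ih =>
      rw [Function.iterate_succ_apply', Function.iterate_succ_apply' f (n + 1)]
      exact riccatiMap_mono hR (hpos n) ih
  -- With `L * G = A` the Joseph form does not depend on the covariance, so one bound serves all
  -- iterates. It applies to values of `f`, hence the passage to `n + 1`.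
  have hbound : ∀ n, f^[n] 0 ≤ C * Cᵀ + L * R * Lᵀ := fun n => by
    refine (hmono n.le_succ).trans ?_
    have := riccatiMap_le_josephForm (A := A) (C := C) (G := G) hR (hpos n) L
    simpa [josephForm, hL, Function.iterate_succ_apply'] using this
  obtain ⟨S, hS, hlim⟩ := Matrix.exists_tendsto_of_monotone hpos hmono hbound
  refine ⟨S, isSteadyStateCov_iff.2 ⟨hS, ?_⟩⟩
  refine tendsto_nhds_unique ((continuousAt_riccatiMap hR hS).tendsto.comp hlim) ?_
  refine ((tendsto_add_atTop_iff_nat 1).2 hlim).congr fun n => ?_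
  rw [Function.iterate_succ_apply']
  rfl

lemma IsSteadyStateCov.mul_transpose_le (hR : R.PosDef) (hS : IsSteadyStateCov A C G R S) :
    C * Cᵀ ≤ S := by
  conv_rhs => rw [← (isSteadyStateCov_iff.1 hS).2]
  exact mul_transpose_le_josephForm hR hS.1 _

lemma IsSteadyStateCov.le_add_mul_mul_transpose (hR : R.PosDef) (hS : IsSteadyStateCov A C G R S)
    {L : Matrix (Fin N) (Fin M) ℝ} (hL : L * G = A) : S ≤ C * Cᵀ + L * R * Lᵀ := by
  have := riccatiMap_le_josephForm (A := A) (C := C) (G := G) hR hS.1 L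
  rw [(isSteadyStateCov_iff.1 hS).2] at this
  simpa [josephForm, hL] using this

lemma Matrix.posDef_mul_transpose_self_of_isUnit (hC : IsUnit C) : (C * Cᵀ).PosDef := by
  have := Matrix.PosDef.mul_conjTranspose_self C (Matrix.vecMul_injective_of_isUnit hC)
  simpa using this

lemma Matrix.PosDef.of_le {P Q : Matrix (Fin N) (Fin N) ℝ} (hP : P.PosDef) (h : P ≤ Q) :
    Q.PosDef := by
  simpa using hP.add_posSemidef (Matrix.le_iff.1 h)

/-- The Riccati map shrinks the relative gap between a covariance and a steady state. -/
lemma IsSteadyStateCov.le_smul_of_le_smul (hR : R.PosDef) (hS : IsSteadyStateCov A C G R S)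
    (hT : IsSteadyStateCov A C G R T) {ε r : ℝ} (hr : 0 ≤ r) (hε : ε • T ≤ C * Cᵀ)
    (h : S ≤ (1 + r) • T) : S ≤ (1 + r * (1 - ε)) • T := by
  set K := kalmanGain A G R T
  have hTeq : C * Cᵀ + K * R * Kᵀ + (A - K * G) * T * (A - K * G)ᵀ = T := hT.2.symm
  -- The gain of `T`, suboptimal for `S`, makes both recursions use the same matrix `A - K * G`.
  have hstep : S ≤ josephForm A C G R ((1 + r) • T) K := by
    conv_lhs => rw [← (isSteadyStateCov_iff.1 hS).2]
    exact (riccatiMap_le_josephForm hR hS.1 K).trans (josephForm_mono h K)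
  have hJ : josephForm A C G R ((1 + r) • T) K
      = T + r • ((A - K * G) * T * (A - K * G)ᵀ) := by
    conv_rhs => enter [1]; rw [← hTeq]
    rw [josephForm, Matrix.mul_smul, Matrix.smul_mul, add_smul, one_smul, add_assoc]
    abel
  -- The contraction: by the equation for `T`, this term is `T` minus `C * Cᵀ` minus a positive
  -- semidefinite noise term, and `C * Cᵀ` is at least the fraction `ε` of `T`.
  have hle : (A - K * G) * T * (A - K * G)ᵀ ≤ (1 - ε) • T := by
    have h0 := Matrix.nonneg_iff_posSemidef.2 (hR.posSemidef.mul_mul_transpose_same K)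
    have e : (A - K * G) * T * (A - K * G)ᵀ = T - C * Cᵀ - K * R * Kᵀ := by
      conv_rhs => enter [1, 1]; rw [← hTeq]
      abel
    rw [e, sub_smul, one_smul]
    exact (sub_le_self _ h0).trans (sub_le_sub_left hε _)
  rw [hJ] at hstep
  refine hstep.trans ?_
  rw [add_smul, one_smul, mul_smul]
  exact add_le_add_right (Matrix.smul_mono_of_nonneg hle hr) _

/-- Invertibility of `C` makes `C * Cᵀ` dominate a multiple `d⁻¹` of `T` and gives an initial
relative gap `c`; each Riccati step multiplies the gap by `1 - d⁻¹ < 1`, so it vanishes in the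
limit. -/
lemma IsSteadyStateCov.le (hR : R.PosDef) (hC : IsUnit C) (hS : IsSteadyStateCov A C G R S)
    (hT : IsSteadyStateCov A C G R T) : S ≤ T := by
  obtain ⟨c, hc, hcS⟩ := Matrix.exists_le_smul_mul_transpose hC hS.1.isHermitian
  obtain ⟨d, hd, hdT⟩ := Matrix.exists_le_smul_mul_transpose hC hT.1.isHermitian
  have hd0 : 0 < d := by linarith
  have hε : d⁻¹ • T ≤ C * Cᵀ := by
    simpa [smul_smul, inv_mul_cancel₀ hd0.ne'] using
      Matrix.smul_mono_of_nonneg hdT (inv_nonneg.2 hd0.le)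
  have hq0 : 0 ≤ 1 - d⁻¹ := sub_nonneg.2 (inv_le_one_of_one_le₀ hd)
  have hq1 : 1 - d⁻¹ < 1 := by linarith [inv_pos.2 hd0]
  have hind : ∀ n : ℕ, S ≤ (1 + c * (1 - d⁻¹) ^ n) • T := fun n => by
    induction n with
    | zero =>
      refine hcS.trans ((Matrix.smul_mono_of_nonneg (hT.mul_transpose_le hR)
        (zero_le_one.trans hc)).trans ?_)
      rw [pow_zero, mul_one, add_smul, one_smul]
      exact le_add_of_nonneg_left (Matrix.nonneg_iff_posSemidef.2 hT.1)
    | succ n ih =>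
      rw [pow_succ, ← mul_assoc]
      exact hS.le_smul_of_le_smul hR hT (by positivity) hε ih
  rw [Matrix.le_iff_dotProduct_mulVec_le hS.1.isHermitian hT.1.isHermitian]
  intro a
  have hlim : Tendsto (fun n : ℕ => (1 + c * (1 - d⁻¹) ^ n) * (a ⬝ᵥ T *ᵥ a)) atTop
      (𝓝 ((1 + c * 0) * (a ⬝ᵥ T *ᵥ a))) :=
    (((tendsto_pow_atTop_nhds_zero_of_lt_one hq0 hq1).const_mul c).const_add 1).mul_const _
  have := ge_of_tendsto' hlim fun n => by
    simpa [Matrix.smul_mulVec] using Matrix.dotProduct_mulVec_le_of_le (hind n) a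
  simpa using this

end Riccati

/-! ### Collapse of the filter under the two-sided bound. -/

section Collapse

open scoped MatrixOrder

variable {N M : ℕ}

lemma Matrix.isUnit_gram_of_rank_eq {G : Matrix (Fin M) (Fin N) ℝ} (hG : G.rank = N) :
    IsUnit (Gᵀ * G) :=
  Matrix.isUnit_of_rank_eq (by rw [Matrix.rank_transpose_mul_self, hG])

lemma Matrix.posDef_gram_of_rank_eq {G : Matrix (Fin M) (Fin N) ℝ} (hG : G.rank = N) :
    (Gᵀ * G).PosDef := by
  have h : (Gᵀ * G).PosSemidef := by simpa using Matrix.posSemidef_mul_transpose_self Gᵀ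
  exact h.posDef_iff_isUnit.2 (Matrix.isUnit_gram_of_rank_eq hG)

lemma Matrix.posDef_smul_one {σ : ℝ} (hσ : 0 < σ) :
    (σ ^ 2 • (1 : Matrix (Fin M) (Fin M) ℝ)).PosDef :=
  Matrix.PosDef.one.smul (by positivity)

/-- The gain of the least squares estimator of the next state is a left factor of `A`. -/
lemma leastSquares_mul {A : Matrix (Fin N) (Fin N) ℝ} {G : Matrix (Fin M) (Fin N) ℝ}
    (hG : G.rank = N) : A * (Gᵀ * G)⁻¹ * Gᵀ * G = A := by
  rw [Matrix.mul_assoc, Matrix.mul_assoc, Matrix.nonsing_inv_mul _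
    ((Matrix.isUnit_iff_isUnit_det _).1 (Matrix.isUnit_gram_of_rank_eq hG)), Matrix.mul_one]

lemma leastSquares_mul_mul_transpose {A : Matrix (Fin N) (Fin N) ℝ}
    {G : Matrix (Fin M) (Fin N) ℝ} (hG : G.rank = N) :
    A * (Gᵀ * G)⁻¹ * Gᵀ * (A * (Gᵀ * G)⁻¹ * Gᵀ)ᵀ = A * (Gᵀ * G)⁻¹ * Aᵀ := by
  have hsymm : ((Gᵀ * G)⁻¹)ᵀ = (Gᵀ * G)⁻¹ :=
    (Matrix.posDef_gram_of_rank_eq hG).inv.posSemidef.transpose_eq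
  have h := leastSquares_mul (A := A) hG
  rw [Matrix.transpose_mul, Matrix.transpose_mul, Matrix.transpose_transpose, hsymm,
    ← Matrix.mul_assoc, ← Matrix.mul_assoc, h]

/-- The push-through identity `hpush` trades the `M × M` inverse for an `N × N` one, whose size does
not grow with `M`. The factor `Γ⁻¹` on the right carries the rate. -/
lemma filterMatrix_eq {A S : Matrix (Fin N) (Fin N) ℝ} {G : Matrix (Fin M) (Fin N) ℝ} {σ : ℝ}
    (hσ : 0 < σ) (hS : S.PosSemidef) (hG : G.rank = N) :
    filterMatrix A G (σ ^ 2 • 1) S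
      = σ ^ 2 • (A * (Gᵀ * G)⁻¹ * (σ ^ 2 • (Gᵀ * G)⁻¹ + S)⁻¹) := by
  have hΓ := Matrix.posDef_gram_of_rank_eq hG
  have hdetΓ := (Matrix.isUnit_iff_isUnit_det _).1 hΓ.isUnit
  have hP : (σ ^ 2 • (Gᵀ * G)⁻¹ + S).PosDef :=
    (hΓ.inv.smul (show 0 < σ ^ 2 by positivity)).add_posSemidef hS
  have hdetP := (Matrix.isUnit_iff_isUnit_det _).1 hP.isUnit
  have hdetΩ := (Matrix.isUnit_iff_isUnit_det _).1
    (innovationCov_posDef (G := G) (Matrix.posDef_smul_one hσ) hS).isUnit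
  have hpush : G * (σ ^ 2 • 1 + S * (Gᵀ * G)) = (G * S * Gᵀ + σ ^ 2 • 1) * G := by
    simp [Matrix.mul_add, Matrix.add_mul, Matrix.mul_assoc, add_comm]
  have hF : filterMatrix A G (σ ^ 2 • 1) S * (σ ^ 2 • 1 + S * (Gᵀ * G)) = σ ^ 2 • A := by
    rw [filterMatrix, Matrix.sub_mul, Matrix.mul_assoc, hpush, kalmanGain,
      ← Matrix.mul_assoc _ (G * S * Gᵀ + σ ^ 2 • 1) G, Matrix.nonsing_inv_mul_cancel_right _ _ hdetΩ]
    simp [Matrix.mul_add, Matrix.mul_assoc]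
  have hfac : σ ^ 2 • 1 + S * (Gᵀ * G) = (σ ^ 2 • (Gᵀ * G)⁻¹ + S) * (Gᵀ * G) := by
    rw [Matrix.add_mul, Matrix.smul_mul, Matrix.nonsing_inv_mul _ hdetΓ]
  rw [hfac, ← Matrix.mul_assoc] at hF
  calc filterMatrix A G (σ ^ 2 • 1) S
      = filterMatrix A G (σ ^ 2 • 1) S * (σ ^ 2 • (Gᵀ * G)⁻¹ + S) * (Gᵀ * G) * (Gᵀ * G)⁻¹
          * (σ ^ 2 • (Gᵀ * G)⁻¹ + S)⁻¹ := by
        rw [Matrix.mul_nonsing_inv_cancel_right _ _ hdetΓ,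
          Matrix.mul_nonsing_inv_cancel_right _ _ hdetP]
    _ = _ := by rw [hF, Matrix.smul_mul, Matrix.smul_mul]

lemma FactorModelAssumption.tendsto_gram_inv {A : Matrix (Fin N) (Fin N) ℝ}
    {G : ∀ M : ℕ, Matrix (Fin M) (Fin N) ℝ} {R : ∀ M : ℕ, Matrix (Fin M) (Fin M) ℝ} {σ : ℝ}
    (h : FactorModelAssumption A G R σ) :
    Tendsto (fun M => ((G M)ᵀ * G M)⁻¹) atTop (𝓝 0) :=
  h.gram_inv_isBigO.of_norm_left.trans_tendsto (tendsto_inv_atTop_nhds_zero_nat (𝕜 := ℝ))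

/-- Covariances that are squeezed between `C Cᵀ` and the error covariance of the least squares
predictor collapse. -/
lemma FactorModelAssumption.filterCollapses {A C : Matrix (Fin N) (Fin N) ℝ}
    {G : ∀ M : ℕ, Matrix (Fin M) (Fin N) ℝ} {R : ∀ M : ℕ, Matrix (Fin M) (Fin M) ℝ} {σ : ℝ}
    (h : FactorModelAssumption A G R σ) (hC : IsUnit C) {S : ℕ → Matrix (Fin N) (Fin N) ℝ}
    (hlow : ∀ᶠ M in atTop, C * Cᵀ ≤ S M)
    (hupp : ∀ᶠ M in atTop, S M ≤ C * Cᵀ + σ ^ 2 • (A * ((G M)ᵀ * G M)⁻¹ * Aᵀ)) :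
    FilterCollapses A C G R S := by
  have hCC := Matrix.posDef_mul_transpose_self_of_isUnit hC
  have hpos : ∀ᶠ M in atTop, (S M).PosSemidef := hlow.mono fun M hM => (hCC.of_le hM).posSemidef
  have hΓ := h.tendsto_gram_inv
  have hup : Tendsto (fun M => C * Cᵀ + σ ^ 2 • (A * ((G M)ᵀ * G M)⁻¹ * Aᵀ)) atTop
      (𝓝 (C * Cᵀ)) := by
    have : Tendsto (fun M => C * Cᵀ + σ ^ 2 • (A * ((G M)ᵀ * G M)⁻¹ * Aᵀ)) atTop
        (𝓝 (C * Cᵀ + σ ^ 2 • (A * 0 * Aᵀ))) :=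
      (((hΓ.const_mul A).mul_const Aᵀ).const_smul (σ ^ 2)).const_add (C * Cᵀ)
    simpa using this
  have hS : Tendsto S atTop (𝓝 (C * Cᵀ)) := by
    refine Matrix.tendsto_of_dotProduct_mulVec (hpos.mono fun M hM => hM.isHermitian)
      hCC.isHermitian fun a => ?_
    refine tendsto_of_tendsto_of_tendsto_of_le_of_le' tendsto_const_nhds
      (Matrix.tendsto_dotProduct_mulVec hup a) ?_ ?_
    · exact hlow.mono fun M hM => Matrix.dotProduct_mulVec_le_of_le hM a
    · exact hupp.mono fun M hM => Matrix.dotProduct_mulVec_le_of_le hM a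
  -- The limit `C * Cᵀ` is invertible, so these inverses stay bounded and the order of the filter
  -- matrix is that of the inverse Gram matrix.
  have hinv : Tendsto (fun M => (σ ^ 2 • ((G M)ᵀ * G M)⁻¹ + S M)⁻¹) atTop (𝓝 (C * Cᵀ)⁻¹) := by
    have hlim : Tendsto (fun M => σ ^ 2 • ((G M)ᵀ * G M)⁻¹ + S M) atTop (𝓝 (C * Cᵀ)) := by
      simpa using (hΓ.const_smul (σ ^ 2)).add hS
    exact (Matrix.continuousAt_nonsing_inv hCC.isUnit).tendsto.comp hlim
  have hF : (fun M => filterMatrix A (G M) (R M) (S M)) =O[atTop] fun M : ℕ => (M : ℝ)⁻¹ := by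
    have h1 : (fun M => σ ^ 2 • (A * ((G M)ᵀ * G M)⁻¹ * (σ ^ 2 • ((G M)ᵀ * G M)⁻¹ + S M)⁻¹))
        =O[atTop] fun M : ℕ => (M : ℝ)⁻¹ := by
      have := (((isBigO_const_const A (one_ne_zero (α := ℝ)) atTop).mul
        h.gram_inv_isBigO.of_norm_left).mul (hinv.isBigO_one ℝ)).const_smul_left (σ ^ 2)
      simp only [one_mul, mul_one] at this
      exact this
    refine h1.congr' ?_ EventuallyEq.rfl
    filter_upwards [hpos, h.rank_G] with M hM hG
    rw [h.noise, filterMatrix_eq h.sigma_pos hM hG]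
  refine ⟨hS, hF.trans_tendsto (tendsto_inv_atTop_nhds_zero_nat (𝕜 := ℝ)), ?_⟩
  obtain ⟨c, hc⟩ := hF.bound
  refine lt_of_le_of_lt (b := (c : EReal)) ?_ (EReal.coe_lt_top c)
  refine limsup_le_of_le (by isBoundedDefault) ?_
  filter_upwards [hc, eventually_gt_atTop 0] with M hM hM0
  have hM' : (0 : ℝ) < M := by exact_mod_cast hM0
  rw [EReal.coe_le_coe_iff]
  calc (M : ℝ) * ‖filterMatrix A (G M) (R M) (S M)‖ ≤ M * (c * ‖(M : ℝ)⁻¹‖) := by gcongr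
    _ = c := by
      rw [Real.norm_of_nonneg (inv_nonneg.2 hM'.le)]
      field_simp

end Collapse

/-! ### Prediction covariances of stationary realizations. -/

section Prediction

open scoped MatrixOrder NNReal

variable {N M n : ℕ} {Ω : Type*} {mΩ : MeasurableSpace Ω} {μ : Measure Ω}

lemma memLp_dotProduct {X : Ω → Fin n → ℝ} (hX : ∀ i, MemLp (fun ω => X ω i) 2 μ)
    (c : Fin n → ℝ) : MemLp (fun ω => c ⬝ᵥ X ω) 2 μ :=
  memLp_finsetSum _ fun i _ => (hX i).const_mul (c i)

lemma memLp_apply_of_isGaussian_map {X : Ω → Fin n → ℝ} (hX : Measurable X)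
    (h : IsGaussian (μ.map X)) (i : Fin n) : MemLp (fun ω => X ω i) 2 μ := by
  have h2 : MemLp X 2 μ := (memLp_map_measure_iff (g := id) aestronglyMeasurable_id
    hX.aemeasurable).1 (IsGaussian.memLp_two_id (μ := μ.map X))
  exact h2.eval i

lemma map_apply_of_map_eq_pi_gaussianReal {X : Ω → Fin n → ℝ} (hX : Measurable X) {v : ℝ≥0}
    (h : μ.map X = Measure.pi fun _ => gaussianReal 0 v) (i : Fin n) :
    μ.map (fun ω => X ω i) = gaussianReal 0 v := by
  have := Measure.map_map (μ := μ) (measurable_pi_apply i) hX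
  rw [h, (measurePreserving_eval _ i).map_eq] at this
  exact this.symm

lemma memLp_apply_of_map_eq_pi_gaussianReal {X : Ω → Fin n → ℝ} (hX : Measurable X) {v : ℝ≥0}
    (h : μ.map X = Measure.pi fun _ => gaussianReal 0 v) (i : Fin n) :
    MemLp (fun ω => X ω i) 2 μ := by
  refine (memLp_map_measure_iff (g := id) (f := fun ω => X ω i) aestronglyMeasurable_id
    (by fun_prop)).1 ?_
  rw [map_apply_of_map_eq_pi_gaussianReal hX h i]
  exact memLp_id_gaussianReal 2

lemma integral_dotProduct_of_map_eq_pi_gaussianReal [IsProbabilityMeasure μ]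
    {X : Ω → Fin n → ℝ} (hX : Measurable X) {v : ℝ≥0}
    (h : μ.map X = Measure.pi fun _ => gaussianReal 0 v) (c : Fin n → ℝ) :
    ∫ ω, c ⬝ᵥ X ω ∂μ = 0 := by
  have h0 : ∀ i, ∫ ω, X ω i ∂μ = 0 := fun i => by
    have := integral_map (μ := μ) (φ := fun ω => X ω i) (f := id) (by fun_prop)
      aestronglyMeasurable_id
    rw [map_apply_of_map_eq_pi_gaussianReal hX h i] at this
    simpa using this.symm
  simp only [dotProduct]
  rw [integral_finsetSum _ fun i _ =>
    ((memLp_apply_of_map_eq_pi_gaussianReal hX h i).integrable one_le_two).const_mul (c i)]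
  simp [integral_const_mul, h0]

lemma integral_dotProduct_sq_of_map_eq_pi_gaussianReal [IsProbabilityMeasure μ]
    {X : Ω → Fin n → ℝ} (hX : Measurable X) {v : ℝ≥0}
    (h : μ.map X = Measure.pi fun _ => gaussianReal 0 v) (c : Fin n → ℝ) :
    ∫ ω, (c ⬝ᵥ X ω) ^ 2 ∂μ = v * (c ⬝ᵥ c) := by
  have hmeas : Measurable fun z : Fin n → ℝ => c ⬝ᵥ z := by
    unfold dotProduct
    fun_prop
  rw [← variance_of_integral_eq_zero (X := fun ω => c ⬝ᵥ X ω) (hmeas.comp hX).aemeasurable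
    (integral_dotProduct_of_map_eq_pi_gaussianReal hX h c)]
  have h1 := variance_map (μ := μ) (Y := X) hmeas.aemeasurable hX.aemeasurable
  have h2 : Var[∑ i, fun z : Fin n → ℝ => c i * z i; Measure.pi fun _ => gaussianReal 0 v]
      = ∑ i, Var[fun z => c i * z; gaussianReal 0 v] :=
    variance_sum_pi (X := fun i z => c i * z) fun i => (memLp_id_gaussianReal 2).const_mul (c i)
  have h3 : (∑ i, fun z : Fin n → ℝ => c i * z i) = fun z => c ⬝ᵥ z := by
    ext z
    simp [dotProduct]
  rw [h3] at h2
  rw [h] at h1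
  change Var[(fun z => c ⬝ᵥ z) ∘ X; μ] = _
  rw [← h1, h2]
  simp only [dotProduct, Finset.mul_sum]
  refine Finset.sum_congr rfl fun i _ => ?_
  rw [variance_const_mul (c i) (fun z => z), variance_fun_id_gaussianReal]
  ring

/-- The conditional expectation is the best predictor in mean square. -/
lemma integral_sub_condExp_sq_le_variance [IsProbabilityMeasure μ] {m : MeasurableSpace Ω}
    (hm : m ≤ mΩ) {Z W : Ω → ℝ} (hZ : MemLp Z 2 μ) (hW : MemLp W 2 μ)
    (hWm : StronglyMeasurable[m] W) :
    ∫ ω, (Z ω - (μ[Z | m]) ω) ^ 2 ∂μ ≤ Var[Z - W; μ] := by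
  -- Law of total variance for `Z - W`: since `W` is `m`-measurable, the conditional variance is
  -- that of `Z`, and the other summand is nonnegative.
  rw [← integral_condVar_add_variance_condExp hm (hZ.sub hW), condVar, integral_condExp hm]
  refine le_trans (le_of_eq (integral_congr_ae ?_)) (le_add_of_nonneg_right (variance_nonneg _ _))
  filter_upwards [condExp_sub (hZ.integrable one_le_two) (hW.integrable one_le_two) m] with ω hω
  simp only [Pi.pow_apply, Pi.sub_apply, hω,
    condExp_of_stronglyMeasurable hm hWm (hW.integrable one_le_two)]
  ring

/-- An independent shock adds its second moment to the mean squared prediction error. -/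
lemma integral_add_sub_condExp_sq [IsProbabilityMeasure μ] {m m₁ m₂ : MeasurableSpace Ω}
    (hm : m ≤ m₁) (hm₁ : m₁ ≤ mΩ) (hm₂ : m₂ ≤ mΩ) (hindep : Indep m₂ m₁ μ) {Z B : Ω → ℝ}
    (hZ : MemLp Z 2 μ) (hB : MemLp B 2 μ) (hZm : StronglyMeasurable[m₁] Z)
    (hBm : StronglyMeasurable[m₂] B) (hB0 : ∫ ω, B ω ∂μ = 0) :
    ∫ ω, ((Z + B) ω - (μ[Z + B | m]) ω) ^ 2 ∂μ
      = ∫ ω, (Z ω - (μ[Z | m]) ω) ^ 2 ∂μ + ∫ ω, B ω ^ 2 ∂μ := by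
  set D : Ω → ℝ := fun ω => Z ω - (μ[Z | m]) ω
  have hD : MemLp D 2 μ := hZ.sub (hZ.condExp one_le_two)
  have hDm : StronglyMeasurable[m₁] D := hZm.sub (stronglyMeasurable_condExp.mono hm)
  have hDB : IndepFun D B μ := by
    rw [IndepFun_iff_Indep]
    exact indep_of_indep_of_le_left (indep_of_indep_of_le_right hindep.symm
      hBm.measurable.comap_le) hDm.measurable.comap_le
  have hcross : ∫ ω, D ω * B ω ∂μ = 0 := by
    rw [hDB.integral_fun_mul_eq_mul_integral hD.1 hB.1, hB0, mul_zero]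
  have hBcond : μ[B | m] =ᵐ[μ] fun _ => 0 := by
    simpa [hB0] using condExp_indep_eq hm₂ (hm.trans hm₁) hBm (indep_of_indep_of_le_right hindep hm)
  have hae : (fun ω => ((Z + B) ω - (μ[Z + B | m]) ω) ^ 2)
      =ᵐ[μ] fun ω => D ω ^ 2 + 2 * (D ω * B ω) + B ω ^ 2 := by
    filter_upwards [hBcond,
      condExp_add (hZ.integrable one_le_two) (hB.integrable one_le_two) m] with ω h1 h2
    simp only [h2, Pi.add_apply, h1, D]
    ring
  have hDBint : Integrable (fun ω => 2 * (D ω * B ω)) μ := (hD.integrable_mul hB).const_mul 2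
  have hsum : Integrable (fun ω => D ω ^ 2 + 2 * (D ω * B ω)) μ := hD.integrable_sq.add hDBint
  rw [integral_congr_ae hae, integral_add hsum hB.integrable_sq,
    integral_add hD.integrable_sq hDBint, integral_const_mul, hcross]
  ring

lemma pastObs_eq_comap (y : ℤ → Ω → Fin M → ℝ) (t : ℤ) :
    pastObs y t = MeasurableSpace.comap (fun ω (s : Set.Iio t) => y s ω) inferInstance :=
  (MeasurableSpace.comap_process_pi fun s : Set.Iio t => y s).symm

lemma predictionCov_isHermitian (x : ℤ → Ω → Fin N → ℝ) (y : ℤ → Ω → Fin M → ℝ) (t : ℤ) :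
    (predictionCov μ x y t).IsHermitian := by
  ext i j
  simp [predictionCov, mul_comm]

/-- Linearity of conditional expectation turns Loewner bounds on the covariance into bounds on the
mean squared error of predicting the scalar `a ⬝ᵥ x t`. -/
lemma dotProduct_predictionCov_mulVec [IsFiniteMeasure μ] {x : ℤ → Ω → Fin N → ℝ} {y : ℤ → Ω → Fin M → ℝ} {t : ℤ}
    (hx : ∀ i, MemLp (fun ω => x t ω i) 2 μ) (a : Fin N → ℝ) :
    a ⬝ᵥ predictionCov μ x y t *ᵥ a
      = ∫ ω, (a ⬝ᵥ x t ω - (μ[fun ω' => a ⬝ᵥ x t ω' | pastObs y t]) ω) ^ 2 ∂μ := by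
  have hcond : μ[fun ω' => a ⬝ᵥ x t ω' | pastObs y t]
      =ᵐ[μ] fun ω => ∑ i, a i * (μ[fun ω' => x t ω' i | pastObs y t]) ω := by
    have h1 := condExp_finsetSum (μ := μ) (s := Finset.univ)
      (f := fun i => a i • fun ω => x t ω i)
      (fun i _ => ((hx i).const_smul (a i)).integrable one_le_two) (pastObs y t)
    have h2 : ∀ᵐ ω ∂μ, ∀ i, (μ[a i • fun ω' => x t ω' i | pastObs y t]) ω
        = (a i • μ[fun ω' => x t ω' i | pastObs y t]) ω :=
      ae_all_iff.2 fun i => condExp_smul (a i) (fun ω' => x t ω' i) (pastObs y t)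
    have h3 : (∑ i, a i • fun ω => x t ω i) = fun ω => a ⬝ᵥ x t ω := by
      ext ω
      simp [dotProduct]
    rw [h3] at h1
    filter_upwards [h1, h2] with ω h1 h2
    simp [h1, h2]
  have hE : ∀ i, MemLp (fun ω => predictionError μ x y t ω i) 2 μ := fun i =>
    (hx i).sub ((hx i).condExp one_le_two)
  have hint : ∀ i j, Integrable
      (fun ω => predictionError μ x y t ω i * predictionError μ x y t ω j) μ :=
    fun i j => (hE i).integrable_mul (hE j)
  calc a ⬝ᵥ predictionCov μ x y t *ᵥ a
      = ∑ i, ∑ j, ∫ ω, a i * a j *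
          (predictionError μ x y t ω i * predictionError μ x y t ω j) ∂μ := by
        simp only [dotProduct, Matrix.mulVec, predictionCov, Matrix.of_apply, Finset.mul_sum,
          integral_const_mul]
        exact Finset.sum_congr rfl fun i _ => Finset.sum_congr rfl fun j _ => by ring
    _ = ∫ ω, ∑ i, ∑ j, a i * a j *
          (predictionError μ x y t ω i * predictionError μ x y t ω j) ∂μ := by
        rw [integral_finsetSum _ fun i _ => integrable_finsetSum _ fun j _ =>
          (hint i j).const_mul _]
        exact Finset.sum_congr rfl fun i _ =>
          (integral_finsetSum _ fun j _ => (hint i j).const_mul _).symm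
    _ = _ := by
        refine integral_congr_ae ?_
        filter_upwards [hcond] with ω hω
        have : a ⬝ᵥ x t ω - (μ[fun ω' => a ⬝ᵥ x t ω' | pastObs y t]) ω
            = ∑ i, a i * predictionError μ x y t ω i := by
          rw [hω]
          simp [predictionError, dotProduct, mul_sub]
        simp only [this, pow_two, Finset.sum_mul_sum]
        exact Finset.sum_congr rfl fun i _ => Finset.sum_congr rfl fun j _ => by ring

variable {A C : Matrix (Fin N) (Fin N) ℝ} {G : Matrix (Fin M) (Fin N) ℝ} {σ : ℝ}
  {x w : ℤ → Ω → Fin N → ℝ} {y v : ℤ → Ω → Fin M → ℝ}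

lemma IsStationaryDFM.pastObs_le (h : IsStationaryDFM μ A C G σ x w y v) (t : ℤ) :
    pastObs y t ≤ mΩ :=
  iSup_le fun s => (h.measurable_y s).comap_le

/-- The next shock is independent of the current state and the past observables. -/
lemma IsStationaryDFM.indepFun_past (h : IsStationaryDFM μ A C G σ x w y v) (s : ℤ) :
    IndepFun (fun ω => ((fun r : Set.Iio (s + 1) => y r ω), x s ω)) (w (s + 1)) μ := by
  -- `φ` rebuilds the observables before `s + 1`, that is up to `s`, from states and measurement
  -- errors. The rebuilt observables agree with `y` almost surely, as there are countably many
  -- times.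
  let φ : (Set.Iic s → Fin N → ℝ) × (ℤ → Fin M → ℝ) →
      (Set.Iio (s + 1) → Fin M → ℝ) × (Fin N → ℝ) := fun p =>
    (fun r => G *ᵥ p.1 ⟨r, Int.lt_add_one_iff.1 r.2⟩ + p.2 r, p.1 ⟨s, Set.self_mem_Iic⟩)
  let ψ : (Set.Ioi s → Fin N → ℝ) → Fin N → ℝ := fun p => p ⟨s + 1, lt_add_one s⟩
  have hφ : Measurable φ := by
    refine Measurable.prodMk (measurable_pi_iff.2 fun r => ?_) (by fun_prop)
    refine measurable_pi_iff.2 fun i => ?_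
    simp only [Pi.add_apply, Matrix.mulVec, dotProduct]
    fun_prop
  have hψ : Measurable ψ := measurable_pi_apply _
  refine ((h.causal s).comp hφ hψ).congr ?_ EventuallyEq.rfl
  have hae : ∀ᵐ ω ∂μ, ∀ r : Set.Iio (s + 1), y r ω = G *ᵥ x r ω + v r ω :=
    ae_all_iff.2 fun r => h.measurement r
  filter_upwards [hae] with ω hω
  exact Prod.ext (funext fun r => (hω r).symm) rfl

lemma measurable_dotProduct_const {α : Type*} {m : MeasurableSpace α} (c : Fin n → ℝ)
    {f : α → Fin n → ℝ} (hf : Measurable f) : Measurable fun ω => c ⬝ᵥ f ω := by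
  unfold dotProduct
  fun_prop

/-- The error splits into that of predicting `A *ᵥ x s` and the shock `C *ᵥ w (s + 1)`; independence
and mean zero remove the cross term. -/
lemma IsStationaryDFM.dotProduct_predictionCov_mulVec_eq [IsProbabilityMeasure μ]
    (h : IsStationaryDFM μ A C G σ x w y v) (s : ℤ) (a : Fin N → ℝ) :
    a ⬝ᵥ predictionCov μ x y (s + 1) *ᵥ a =
      ∫ ω, ((a ᵥ* A) ⬝ᵥ x s ω - (μ[fun ω' => (a ᵥ* A) ⬝ᵥ x s ω' | pastObs y (s + 1)]) ω) ^ 2 ∂μ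
        + a ⬝ᵥ (C * Cᵀ) *ᵥ a := by
  have hx : ∀ t i, MemLp (fun ω => x t ω i) 2 μ := fun t =>
    memLp_apply_of_isGaussian_map (h.measurable_x t) (h.gaussian_x t)
  have hlaw : μ.map (w (s + 1)) = Measure.pi fun _ => gaussianReal 0 (1 : ℝ≥0) := h.law_w (s + 1)
  have hw := memLp_apply_of_map_eq_pi_gaussianReal (h.measurable_w (s + 1)) hlaw
  set Z : Ω → ℝ := fun ω => (a ᵥ* A) ⬝ᵥ x s ω with hZ
  set B : Ω → ℝ := fun ω => (a ᵥ* C) ⬝ᵥ w (s + 1) ω with hB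
  have hU : (fun ω => a ⬝ᵥ x (s + 1) ω) =ᵐ[μ] Z + B := by
    filter_upwards [h.transition s] with ω hω
    simp [hω, hZ, hB, Matrix.dotProduct_mulVec, dotProduct_add]
  have hYmeas : Measurable fun ω => ((fun r : Set.Iio (s + 1) => y r ω), x s ω) :=
    (measurable_pi_iff.2 fun r : Set.Iio (s + 1) => h.measurable_y r).prodMk (h.measurable_x s)
  have hpast : pastObs y (s + 1) ≤ MeasurableSpace.comap
      (fun ω => ((fun r : Set.Iio (s + 1) => y r ω), x s ω)) inferInstance := by
    rw [pastObs_eq_comap]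
    exact (measurable_fst.comp (comap_measurable
      fun ω => ((fun r : Set.Iio (s + 1) => y r ω), x s ω))).comap_le
  have hindep := (IndepFun_iff_Indep _ _ _).1 (h.indepFun_past s)
  have hB2 : ∫ ω, B ω ^ 2 ∂μ = a ⬝ᵥ (C * Cᵀ) *ᵥ a := by
    rw [integral_dotProduct_sq_of_map_eq_pi_gaussianReal (h.measurable_w (s + 1)) hlaw]
    rw [← Matrix.mulVec_mulVec, Matrix.dotProduct_mulVec, Matrix.mulVec_transpose]
    simp
  rw [dotProduct_predictionCov_mulVec (hx (s + 1)), ← hB2]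
  rw [← integral_add_sub_condExp_sq hpast hYmeas.comap_le (h.measurable_w (s + 1)).comap_le
    hindep.symm (memLp_dotProduct (hx s) _) (memLp_dotProduct hw _)
    (measurable_dotProduct_const _ (measurable_snd.comp (comap_measurable _))).stronglyMeasurable
    (measurable_dotProduct_const _ (comap_measurable _)).stronglyMeasurable
    (integral_dotProduct_of_map_eq_pi_gaussianReal (h.measurable_w (s + 1)) hlaw _)]
  refine integral_congr_ae ?_
  filter_upwards [hU, condExp_congr_ae (m := pastObs y (s + 1)) hU] with ω h1 h2
  rw [h2, ← h1]

lemma IsStationaryDFM.mul_transpose_le_predictionCov [IsProbabilityMeasure μ]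
    (h : IsStationaryDFM μ A C G σ x w y v) (t : ℤ) :
    C * Cᵀ ≤ predictionCov μ x y t := by
  obtain ⟨s, rfl⟩ : ∃ s, t = s + 1 := ⟨t - 1, by ring⟩
  rw [Matrix.le_iff_dotProduct_mulVec_le (Matrix.posSemidef_mul_transpose_self C).isHermitian
    (predictionCov_isHermitian x y _)]
  intro a
  rw [h.dotProduct_predictionCov_mulVec_eq]
  exact le_add_of_nonneg_left (integral_nonneg fun ω => sq_nonneg _)

/-- The last observation alone suffices: `L *ᵥ y s` estimates `A *ᵥ x s` with error `-L *ᵥ v s`, and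
the conditional expectation is at least as good. -/
lemma IsStationaryDFM.predictionCov_le [IsProbabilityMeasure μ]
    (h : IsStationaryDFM μ A C G σ x w y v) (hG : G.rank = N) (t : ℤ) :
    predictionCov μ x y t ≤ C * Cᵀ + σ ^ 2 • (A * (Gᵀ * G)⁻¹ * Aᵀ) := by
  obtain ⟨s, rfl⟩ : ∃ s, t = s + 1 := ⟨t - 1, by ring⟩
  have hpos : (A * (Gᵀ * G)⁻¹ * Aᵀ).PosSemidef :=
    (Matrix.posDef_gram_of_rank_eq hG).inv.posSemidef.mul_mul_transpose_same A
  rw [Matrix.le_iff_dotProduct_mulVec_le (predictionCov_isHermitian x y _)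
    ((Matrix.posSemidef_mul_transpose_self C).add (hpos.smul (sq_nonneg σ))).isHermitian]
  intro a
  rw [h.dotProduct_predictionCov_mulVec_eq, Matrix.add_mulVec, dotProduct_add, add_comm,
    add_le_add_iff_left]
  set L := A * (Gᵀ * G)⁻¹ * Gᵀ with hL
  have hx := memLp_apply_of_isGaussian_map (h.measurable_x s) (h.gaussian_x s)
  have hv := memLp_apply_of_map_eq_pi_gaussianReal (h.measurable_v s) (h.law_v s)
  have hyv : ∀ᵐ ω ∂μ, (a ᵥ* L) ⬝ᵥ y s ω = (a ᵥ* A) ⬝ᵥ x s ω + (a ᵥ* L) ⬝ᵥ v s ω := by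
    filter_upwards [h.measurement s] with ω hω
    rw [hω, dotProduct_add, Matrix.dotProduct_mulVec, Matrix.vecMul_vecMul, hL,
      leastSquares_mul hG]
  have hW : MemLp (fun ω => (a ᵥ* L) ⬝ᵥ y s ω) 2 μ :=
    ((memLp_dotProduct hx (a ᵥ* A)).add (memLp_dotProduct hv (a ᵥ* L))).ae_eq
      (hyv.mono fun ω hω => hω.symm)
  have hle : MeasurableSpace.comap (y s) inferInstance ≤ pastObs y (s + 1) :=
    le_iSup (fun r : Set.Iio (s + 1) => MeasurableSpace.comap (y r) inferInstance)
      ⟨s, lt_add_one s⟩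
  have hWm : StronglyMeasurable[pastObs y (s + 1)] fun ω => (a ᵥ* L) ⬝ᵥ y s ω :=
    ((measurable_dotProduct_const _ (comap_measurable (y s))).mono hle le_rfl).stronglyMeasurable
  refine (integral_sub_condExp_sq_le_variance (h.pastObs_le (s + 1))
    (memLp_dotProduct hx (a ᵥ* A)) hW hWm).trans (le_of_eq ?_)
  have hres : ((fun ω => (a ᵥ* A) ⬝ᵥ x s ω) - fun ω => (a ᵥ* L) ⬝ᵥ y s ω)
      =ᵐ[μ] fun ω => (-(a ᵥ* L)) ⬝ᵥ v s ω := by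
    filter_upwards [hyv] with ω hω
    simp [hω]
  rw [variance_congr hres, variance_of_integral_eq_zero
    (measurable_dotProduct_const _ (h.measurable_v s)).aemeasurable
    (integral_dotProduct_of_map_eq_pi_gaussianReal (h.measurable_v s) (h.law_v s) _),
    integral_dotProduct_sq_of_map_eq_pi_gaussianReal (h.measurable_v s) (h.law_v s),
    Real.coe_toNNReal _ (sq_nonneg σ), neg_dotProduct_neg, Matrix.smul_mulVec, dotProduct_smul,
    smul_eq_mul, ← leastSquares_mul_mul_transpose hG, ← Matrix.mulVec_mulVec,
    Matrix.dotProduct_mulVec, Matrix.mulVec_transpose]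

end Prediction

theorem mainTheorem3 {N : ℕ} (A C : Matrix (Fin N) (Fin N) ℝ)
    (G : ∀ M : ℕ, Matrix (Fin M) (Fin N) ℝ) (R : ∀ M : ℕ, Matrix (Fin M) (Fin M) ℝ) (σ : ℝ)
    (hassum : FactorModelAssumption A G R σ) (hC : C.rank = N) :
    -- the steady-state covariance exists, is unique and is invertible
    (∀ M, (G M).rank = N →
      (∃! S, IsSteadyStateCov A C (G M) (R M) S) ∧
      ∀ S, IsSteadyStateCov A C (G M) (R M) S → IsUnit S) ∧
    -- the asymptotic claims for the steady-state covariances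
    (∀ S : ℕ → Matrix (Fin N) (Fin N) ℝ,
      (∀ᶠ M in atTop, IsSteadyStateCov A C (G M) (R M) (S M)) →
      FilterCollapses A C G R S) ∧
    -- the same claims for the prediction covariances of stationary realizations of the models
    (∀ (Ω : ℕ → Type*) (_ : ∀ M, MeasurableSpace (Ω M)) (μ : ∀ M, Measure (Ω M))
      (_ : ∀ M, IsProbabilityMeasure (μ M))
      (x w : ∀ M, ℤ → Ω M → Fin N → ℝ) (y v : ∀ M, ℤ → Ω M → Fin M → ℝ),
      (∀ᶠ M in atTop, IsStationaryDFM (μ M) A C (G M) σ (x M) (w M) (y M) (v M)) →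
      ∀ t : ℤ, FilterCollapses A C G R fun M => predictionCov (μ M) (x M) (y M) t) := by
  have hCu : IsUnit C := Matrix.isUnit_of_rank_eq hC
  have hR : ∀ M, (R M).PosDef := fun M => by
    rw [hassum.noise M]
    exact Matrix.posDef_smul_one hassum.sigma_pos
  refine ⟨fun M hG => ⟨?_, fun S hS => ?_⟩, fun S hS => ?_, ?_⟩
  · obtain ⟨S, hS⟩ := exists_isSteadyStateCov (C := C) (hR M) (leastSquares_mul hG)
    exact ⟨S, hS, fun T hT =>
      -- Antisymmetry of the Loewner order, whose instance is scoped and not open here.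
      letI := Matrix.instPartialOrder (𝕜 := ℝ) (n := Fin N)
      le_antisymm (hT.le (hR M) hCu hS) (hS.le (hR M) hCu hT)⟩
  · exact ((Matrix.posDef_mul_transpose_self_of_isUnit hCu).of_le
      (hS.mul_transpose_le (hR M))).isUnit
  · refine hassum.filterCollapses hCu (hS.mono fun M hM => hM.mul_transpose_le (hR M)) ?_
    filter_upwards [hS, hassum.rank_G] with M hM hG
    have := hM.le_add_mul_mul_transpose (hR M) (leastSquares_mul hG)
    rwa [hassum.noise M, Matrix.mul_smul, Matrix.mul_one, Matrix.smul_mul,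
      leastSquares_mul_mul_transpose hG] at this
  · intro Ω _ μ _ x w y v h t
    refine hassum.filterCollapses hCu (h.mono fun M hM => hM.mul_transpose_le_predictionCov t) ?_
    filter_upwards [h, hassum.rank_G] with M hM hG
    exact hM.predictionCov_le hG t
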